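/- Let $\mathcal{E}$ be an elementary topos (finite limits, exponentials and a subobject classifier). Write $1$ for its terminal object and $2=1+1$. Call an object $X$ decidable if its diagonal $X\rightarrowtail X\times X$ is a complemented subobject, and let $\mathrm{dec}(\mathcal{E})$ be the full subcategory of decidable objects. Suppose that (NS) every object of $\mathcal{E}$ is either initial or has a global element $1\to X$, and that the inclusion $\mathcal{I}:\mathrm{dec}(\mathcal{E})\to\mathcal{E}$ has a left adjoint $\Pi$. Then (DQO) for every object $X$ there is an epimorphism $q:X\twoheadrightarrow Q$ with $Q$ decidable such that every arrow $X\to 2$ factors uniquely through $q$; and if $q:X\twoheadrightarrow Q$ and $q':X\twoheadrightarrow Q'$ are two such epimorphisms, then there is a unique isomorphism $e:Q\to Q'$ with $e\circ q=q'$. Moreover, for every $X$ the unit $p_X:X\to\mathcal{I}\Pi X$ of the adjunction is such a decidable quotient of $X$. -/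

import Mathlib

open CategoryTheory Limits MonoidalCategory CartesianMonoidalCategory

universe v u

namespace DecidableTopos

section

variable (C : Type u) [Category.{v} C] [CartesianMonoidalCategory C]

/-- The Nullstellensatz: every object is initial or has a global element. -/
def NS : Prop :=
  ∀ X : C, Nonempty (IsInitial X) ∨ Nonempty (𝟙_ C ⟶ X)

variable {C}

/-- An object `X` is decidable if its diagonal `X ⟶ X ⊗ X` (here `⊗` is the cartesian product) is a
complemented subobject: there is `m : D ⟶ X ⊗ X` such that `X ⊗ X` is the coproduct of the diagonal
and of `m`. -/
def IsDecidable (X : C) : Prop :=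
  ∃ (D : C) (m : D ⟶ X ⊗ X),
    Nonempty (IsColimit (BinaryCofan.mk (lift (𝟙 X) (𝟙 X)) m))

variable (C) in
/-- The full subcategory of decidable objects, given as a property of objects. -/
def dec : ObjectProperty C := fun X => IsDecidable X

/-- `i, j : 1 ⟶ T` exhibit `T` as the coproduct `2 = 1 + 1`. -/
def IsTwo {T : C} (i j : 𝟙_ C ⟶ T) : Prop :=
  Nonempty (IsColimit (BinaryCofan.mk i j))

/-- The coproduct `2 = 1 + 1` exists and every arrow `X ⟶ 2` factors uniquely through `q`. As `2` is
unique up to isomorphism, it does not matter which copy of it is used. -/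
def FactorsArrowsToTwo {X Q : C} (q : X ⟶ Q) : Prop :=
  ∃ (T : C) (i j : 𝟙_ C ⟶ T), IsTwo i j ∧ ∀ f : X ⟶ T, ∃! g : Q ⟶ T, q ≫ g = f

/-- `q : X ⟶ Q` is a decidable quotient of `X` along which any arrow to `2` factors uniquely. -/
structure IsDecidableQuotient {X Q : C} (q : X ⟶ Q) : Prop where
  epi : Epi q
  decidable : IsDecidable Q
  factors : FactorsArrowsToTwo q

variable (C) in
/-- Every object has a unique decidable quotient along which any arrow to `2` factors uniquely.
Uniqueness is that of quotients: any two are isomorphic under `X`, by a unique isomorphism. -/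
def DQO : Prop :=
  ∀ X : C,
    (∃ (Q : C) (q : X ⟶ Q), IsDecidableQuotient q) ∧
    ∀ (Q Q' : C) (q : X ⟶ Q) (q' : X ⟶ Q'), IsDecidableQuotient q → IsDecidableQuotient q' →
      ∃! e : Q ≅ Q', q ≫ e.hom = q'

end

end DecidableTopos

/-! The unit `p` is epic because subobjects of decidable objects are decidable: if `p` equalizes `u`
and `v`, it factors through their equalizer, and uniqueness of factorizations splits that inclusion.
Arrows to 2 factor through `p` because 2 is decidable. Any other decidable quotient is `p ≫ k`, with
`k` epic; it is also monic, since NS yields a point where injectivity fails, and decidable equality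
turns it into an arrow to 2 that cannot factor through `k`. A topos is balanced, so `k` is
invertible.

Coproducts are not assumed: 2 is built inside `Ω` as the least subobject containing true and another
point (`exists_isTruthTwo`), and NS lets truth values be compared at points (`point_ext`).
Decidability becomes an equality test with values in 2 (`exists_decidesEq`); `isColimit_fibres`
recovers the complement. The degenerate topos is treated apart. -/

open HasSubobjectClassifier MonoidalClosed

namespace DecidableTopos

section JointlyEpic

variable {C : Type u} [Category.{v} C]

/-- Two arrows with common codomain are jointly epic. -/
def JointlyEpic {A B X : C} (a : A ⟶ X) (b : B ⟶ X) : Prop :=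
  ∀ ⦃Z : C⦄ (u v : X ⟶ Z), a ≫ u = a ≫ v → b ≫ u = b ≫ v → u = v

theorem jointlyEpic_of_isColimit {A B X : C} {a : A ⟶ X} {b : B ⟶ X}
    (h : Nonempty (IsColimit (BinaryCofan.mk a b))) : JointlyEpic a b :=
  fun _ _ _ h₁ h₂ => BinaryCofan.IsColimit.hom_ext h.some h₁ h₂

theorem exists_desc {A B X : C} {a : A ⟶ X} {b : B ⟶ X}
    (h : Nonempty (IsColimit (BinaryCofan.mk a b))) {Z : C} (f : A ⟶ Z) (g : B ⟶ Z) :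
    ∃ d : X ⟶ Z, a ≫ d = f ∧ b ≫ d = g := by
  obtain ⟨d, h₁, h₂⟩ := BinaryCofan.IsColimit.desc' h.some f g
  exact ⟨d, h₁, h₂⟩

theorem nonempty_isColimit {A B X : C} {a : A ⟶ X} {b : B ⟶ X} (h : JointlyEpic a b)
    (hd : ∀ ⦃Z : C⦄ (f : A ⟶ Z) (g : B ⟶ Z), ∃ d : X ⟶ Z, a ≫ d = f ∧ b ≫ d = g) :
    Nonempty (IsColimit (BinaryCofan.mk a b)) := by
  choose d h₁ h₂ using hd
  exact ⟨BinaryCofan.isColimitMk (fun s => d s.inl s.inr) (fun s => h₁ _ _) (fun s => h₂ _ _)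
    fun s m w₁ w₂ => h _ _ (w₁.trans (h₁ _ _).symm) (w₂.trans (h₂ _ _).symm)⟩

end JointlyEpic

/-! ### Subobjects as truth-valued maps -/

section Classifier

variable {C : Type u} [Category.{v} C] [HasSubobjectClassifier C]

/-- The characteristic map of the largest subobject. -/
noncomputable def top (X : C) : X ⟶ Ω C :=
  Subobject.Classifier.χ₀ _ X ≫ truth C

@[simp]
theorem comp_top {X Y : C} (f : X ⟶ Y) : f ≫ top Y = top X := by
  unfold top
  rw [← Category.assoc]
  congr 1
  exact Subsingleton.elim _ _

theorem comp_χ_eq_top_iff {U X Y : C} (m : U ⟶ X) [Mono m] (t : Y ⟶ X) :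
    t ≫ χ m = top Y ↔ ∃ s, s ≫ m = t := by
  constructor
  · intro h
    exact ⟨(isPullback_χ m).lift t _ h, (isPullback_χ m).lift_fst _ _ _⟩
  · rintro ⟨s, rfl⟩
    rw [Category.assoc, HasSubobjectClassifier.comm, ← comp_top s]
    rfl

variable [HasFiniteLimits C]

/-- Both maps classify the equalizer of `u` with true. -/
theorem hom_ext_of_top {X : C} {u v : X ⟶ Ω C}
    (h : ∀ ⦃Y : C⦄ (t : Y ⟶ X), t ≫ u = top Y ↔ t ≫ v = top Y) : u = v := by
  have key : ∀ w : X ⟶ Ω C, (∀ ⦃Y : C⦄ (t : Y ⟶ X), t ≫ w = top Y ↔ t ≫ u = top Y) →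
      w = χ (equalizer.ι u (top X)) := by
    intro w hw
    refine unique _ _ ⟨⟨?_⟩, ⟨PullbackCone.IsLimit.mk _
      (fun s => equalizer.lift s.fst ?_) (fun s => ?_) (fun s => ?_) (fun s m h₁ _ => ?_)⟩⟩
    · exact (hw _).2 (by rw [equalizer.condition, comp_top])
    · rw [comp_top]
      refine (hw _).1 ?_
      rw [s.condition]
      unfold top
      congr 1
      exact Subsingleton.elim _ _
    · simp
    · exact Subsingleton.elim _ _
    · rw [← cancel_mono (equalizer.ι u (top X))]
      simpa using h₁
  rw [key u fun _ _ => Iff.rfl, key v fun _ t => (h t).symm]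

/-- Direct image of a subobject along a monomorphism, for characteristic maps. -/
theorem exists_image {U X : C} (m : U ⟶ X) [Mono m] (u : U ⟶ Ω C) :
    ∃ w : X ⟶ Ω C, m ≫ w = u ∧
      ∀ ⦃Y : C⦄ (t : Y ⟶ X), t ≫ w = top Y ↔ ∃ s, s ≫ m = t ∧ s ≫ u = top Y := by
  have key : ∀ ⦃Y : C⦄ (t : Y ⟶ X), t ≫ χ (equalizer.ι u (top U) ≫ m) = top Y ↔
      ∃ s, s ≫ m = t ∧ s ≫ u = top Y := by
    intro Y t
    rw [comp_χ_eq_top_iff]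
    constructor
    · rintro ⟨s, rfl⟩
      exact ⟨s ≫ equalizer.ι u (top U), by simp, by rw [Category.assoc, equalizer.condition, comp_top, comp_top]⟩
    · rintro ⟨s, rfl, h⟩
      exact ⟨equalizer.lift s (by simpa using h), by simp⟩
  refine ⟨_, hom_ext_of_top fun Y t => ?_, key⟩
  rw [← Category.assoc, key]
  constructor
  · rintro ⟨s, h, hs⟩
    rwa [← (cancel_mono m).1 h]
  · exact fun h => ⟨t, rfl, h⟩

theorem eq_of_χ_equalizer_eq_top {X Y : C} {f g : X ⟶ Y}
    (h : χ (equalizer.ι f g) = top X) : f = g := by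
  obtain ⟨s, hs⟩ := (comp_χ_eq_top_iff (equalizer.ι f g) (𝟙 X)).1 (by simpa using h)
  rw [← Category.id_comp f, ← Category.id_comp g, ← hs, Category.assoc, Category.assoc,
    equalizer.condition]

/-- Joint epimorphy can be tested on arrows to the subobject classifier. -/
theorem jointlyEpic_of_classifier {A B X : C} {a : A ⟶ X} {b : B ⟶ X}
    (h : ∀ u v : X ⟶ Ω C, a ≫ u = a ≫ v → b ≫ u = b ≫ v → u = v) : JointlyEpic a b := by
  intro Z u v h₁ h₂
  refine eq_of_χ_equalizer_eq_top (h _ _ ?_ ?_) <;> rw [comp_top, comp_χ_eq_top_iff]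
  · exact ⟨equalizer.lift a h₁, by simp⟩
  · exact ⟨equalizer.lift b h₂, by simp⟩

omit [HasFiniteLimits C] in
theorem JointlyEpic.exists_lift {A B X U : C} {a : A ⟶ X} {b : B ⟶ X} (h : JointlyEpic a b)
    {Y : C} (m : U ⟶ Y) [Mono m] (f : X ⟶ Y) (ha : ∃ s, s ≫ m = a ≫ f)
    (hb : ∃ s, s ≫ m = b ≫ f) : ∃ s, s ≫ m = f := by
  rw [← comp_χ_eq_top_iff] at *
  exact h _ _ (by simpa using ha) (by simpa using hb)

end Classifier

/-! ### Products with 2, by cartesian closedness -/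

section Products

variable {C : Type u} [Category.{v} C] [CartesianMonoidalCategory C]

/-- The constant arrow at a global element. -/
def const (Y : C) {X : C} (x : 𝟙_ C ⟶ X) : Y ⟶ X := toUnit Y ≫ x

@[simp]
theorem comp_const {Y Z X : C} (f : Y ⟶ Z) (x : 𝟙_ C ⟶ X) : f ≫ const Z x = const Y x := by
  simp [const]

@[simp]
theorem const_comp {Y X Z : C} (x : 𝟙_ C ⟶ X) (f : X ⟶ Z) : const Y x ≫ f = const Y (x ≫ f) := by
  simp [const]

@[simp]
theorem const_unit {X : C} (x : 𝟙_ C ⟶ X) : const (𝟙_ C) x = x := by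
  simp [const, toUnit_unique (toUnit (𝟙_ C)) (𝟙 _)]

instance mono_lift_id_left {X Y : C} (f : X ⟶ Y) : Mono (lift (𝟙 X) f) :=
  ⟨fun a b h => by simpa using h =≫ fst X Y⟩

instance mono_whiskerLeft (Z : C) {X Y : C} (f : X ⟶ Y) [Mono f] : Mono (Z ◁ f) :=
  ⟨fun a b h => by
    refine CartesianMonoidalCategory.hom_ext _ _ (by simpa using h =≫ fst Z Y) ?_
    rw [← cancel_mono f]
    simpa using h =≫ snd Z Y⟩

theorem lift_const_comp {X T Z : C} (i : 𝟙_ C ⟶ T) (u : X ⊗ T ⟶ Z) :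
    lift (𝟙 X) (const X i) ≫ u = lift (𝟙 X) (toUnit X) ≫ X ◁ i ≫ u := by
  simp [const]

theorem whiskerLeft_comp_eq {X T Z : C} (i : 𝟙_ C ⟶ T) (u : X ⊗ T ⟶ Z) :
    X ◁ i ≫ u = fst _ _ ≫ lift (𝟙 X) (const X i) ≫ u := by
  rw [← Category.assoc]
  congr 1
  ext <;> simp [const]
  rw [toUnit_unique (snd X (𝟙_ C)) (toUnit _)]

variable [MonoidalClosed C]

theorem JointlyEpic.prod {T : C} {i j : 𝟙_ C ⟶ T} (h : JointlyEpic i j) (X : C) :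
    JointlyEpic (lift (𝟙 X) (const X i)) (lift (𝟙 X) (const X j)) := by
  intro Z u v h₁ h₂
  refine curry_injective (h _ _ ?_ ?_)
  · rw [← curry_natural_left, ← curry_natural_left, whiskerLeft_comp_eq, h₁, whiskerLeft_comp_eq]
  · rw [← curry_natural_left, ← curry_natural_left, whiskerLeft_comp_eq, h₂, whiskerLeft_comp_eq]

/-- Arrows on `X ⊗ 2` can be defined by cases. -/
theorem exists_prod_desc {T : C} {i j : 𝟙_ C ⟶ T} (h : IsTwo i j) {X Z : C} (a b : X ⟶ Z) :
    ∃ d : X ⊗ T ⟶ Z, lift (𝟙 X) (const X i) ≫ d = a ∧ lift (𝟙 X) (const X j) ≫ d = b := by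
  obtain ⟨d, h₁, h₂⟩ := exists_desc h (curry (fst X (𝟙_ C) ≫ a)) (curry (fst X (𝟙_ C) ≫ b))
  refine ⟨uncurry d, ?_, ?_⟩
  · rw [lift_const_comp, ← uncurry_natural_left, h₁, uncurry_curry]
    simp
  · rw [lift_const_comp, ← uncurry_natural_left, h₂, uncurry_curry]
    simp

end Products

/-! ### Least subobjects and coproduct decompositions -/

section Topos

variable {C : Type u} [Category.{v} C] [HasFiniteLimits C] [CartesianMonoidalCategory C]
  [MonoidalClosed C] [HasSubobjectClassifier C]

/-- Two global elements lie in a least subobject, on which they are jointly epic. -/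
theorem exists_jointlyEpic {X : C} (p q : 𝟙_ C ⟶ X) :
    ∃ (G : C) (g : G ⟶ X) (i j : 𝟙_ C ⟶ G),
      Mono g ∧ i ≫ g = p ∧ j ≫ g = q ∧ JointlyEpic i j := by
  let mem : X ⊗ (ihom X).obj (Ω C) ⟶ Ω C := (ihom.ev X).app (Ω C)
  let e (x : 𝟙_ C ⟶ X) : (ihom X).obj (Ω C) ⟶ Ω C := lift (const _ x) (𝟙 _) ≫ mem
  -- `W` is the object of subobjects of `X` containing `p` and `q`; `g` below is their internal
  -- intersection.
  let W := equalizer (lift (e p) (e q)) (lift (top _) (top _))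
  let w : W ⟶ (ihom X).obj (Ω C) := equalizer.ι _ _
  have hw : w ≫ lift (e p) (e q) = w ≫ lift (top _) (top _) := equalizer.condition _ _
  have hp : w ≫ e p = top W := by simpa using hw =≫ fst _ _
  have hq : w ≫ e q = top W := by simpa using hw =≫ snd _ _
  let M : W ⊗ X ⟶ Ω C := lift (snd _ _) (fst _ _ ≫ w) ≫ mem
  let g : equalizer (curry M) (curry (top _)) ⟶ X := equalizer.ι _ _
  have hpt : ∀ x : 𝟙_ C ⟶ X, w ≫ e x = top W → x ≫ curry M = x ≫ curry (top _) := by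
    intro x hx
    rw [← curry_natural_left, ← curry_natural_left]
    congr 1
    have : W ◁ x ≫ M = fst _ _ ≫ w ≫ e x := by
      simp only [M, e, ← Category.assoc]
      congr 1
      ext
      · simp [const, toUnit_unique (snd W (𝟙_ C)) (toUnit _)]
      · simp
    rw [this, hx, comp_top, comp_top]
  refine ⟨_, g, equalizer.lift p (hpt p hp), equalizer.lift q (hpt q hq), inferInstance,
    by simp [g], by simp [g], ?_⟩
  intro Z u v h₁ h₂
  -- The equalizer of `u` and `v`, seen in `X`, contains `p` and `q`; its name `n` is thus a point
  -- of `W`, and the intersection lies in it.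
  let S : X ⟶ Ω C := χ (equalizer.ι u v ≫ g)
  let n : 𝟙_ C ⟶ (ihom X).obj (Ω C) := curry (fst X (𝟙_ C) ≫ S)
  have hn : ∀ {Y : C} (t : Y ⟶ X), lift t (const Y n) ≫ mem = t ≫ S := by
    intro Y t
    have : lift t (const Y n) = lift t (toUnit Y) ≫ X ◁ n := by simp [const]
    rw [this, Category.assoc]
    change _ ≫ _ ◁ curry _ ≫ (ihom.ev X).app (Ω C) = _
    rw [← uncurry_eq, uncurry_curry]
    simp
  have hne : ∀ x : 𝟙_ C ⟶ X, n ≫ e x = x ≫ S := by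
    intro x
    rw [← hn x, const_unit, ← Category.assoc, comp_lift, comp_const, const_unit, Category.comp_id]
  obtain ⟨n', hn'⟩ : ∃ n' : 𝟙_ C ⟶ W, n' ≫ w = n := by
    refine ⟨equalizer.lift n ?_, equalizer.lift_ι _ _⟩
    ext
    · simp only [Category.assoc, lift_fst, hne, comp_top]
      exact (comp_χ_eq_top_iff _ _).2 ⟨equalizer.lift _ h₁, by simp [g]⟩
    · simp only [Category.assoc, lift_snd, hne, comp_top]
      exact (comp_χ_eq_top_iff _ _).2 ⟨equalizer.lift _ h₂, by simp [g]⟩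
  have hg : g ≫ S = top _ := by
    have h : g ≫ curry M = g ≫ curry (top _) := equalizer.condition _ _
    rw [← curry_natural_left, ← curry_natural_left] at h
    have h' := lift (const _ n') (𝟙 _) ≫= curry_injective h
    simp only [comp_top] at h'
    rw [← h', ← hn g]
    simp only [M, ← Category.assoc]
    congr 1
    ext <;> simp [hn']
  obtain ⟨s, hs⟩ := (comp_χ_eq_top_iff _ _).1 hg
  have hs' : s ≫ equalizer.ι u v = 𝟙 _ := by
    rw [← cancel_mono g]
    simpa using hs
  rw [← Category.id_comp u, ← Category.id_comp v, ← hs', Category.assoc, Category.assoc,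
    equalizer.condition]

omit [HasFiniteLimits C] [MonoidalClosed C] in
theorem lift_comp_χ_diag {X Y : C} (s t : Y ⟶ X) :
    lift s t ≫ χ (lift (𝟙 X) (𝟙 X)) = top Y ↔ s = t := by
  rw [comp_χ_eq_top_iff]
  constructor
  · rintro ⟨r, hr⟩
    have e₁ : r = s := by simpa using hr =≫ fst _ _
    have e₂ : r = t := by simpa using hr =≫ snd _ _
    exact e₁.symm.trans e₂
  · rintro rfl
    exact ⟨s, by simp⟩

/-- `y` is the fibre of `f` over the global element `i`. -/
structure IsFibre {Y₀ Y T : C} (y : Y₀ ⟶ Y) (f : Y ⟶ T) (i : 𝟙_ C ⟶ T) : Prop where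
  mono : Mono y
  comp : y ≫ f = const Y₀ i
  lift : ∀ ⦃W : C⦄ (t : W ⟶ Y), t ≫ f = const W i → ∃ s, s ≫ y = t

omit [MonoidalClosed C] [HasSubobjectClassifier C] in
theorem isFibre_equalizer {Y T : C} (f : Y ⟶ T) (i : 𝟙_ C ⟶ T) :
    IsFibre (equalizer.ι f (const Y i)) f i where
  mono := inferInstance
  comp := by rw [equalizer.condition, comp_const]
  lift W t ht := ⟨equalizer.lift t (by simpa using ht), by simp⟩

/-- Pushed forward along the graph of `f`, subobjects of `Y` are compared on the slices of `Y ⊗ T`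
at `i` and `j`, which see only the fibres. -/
theorem JointlyEpic.fibres {T : C} {i j : 𝟙_ C ⟶ T} (h : JointlyEpic i j) {Y Y₀ Y₁ : C}
    {f : Y ⟶ T} {y₀ : Y₀ ⟶ Y} {y₁ : Y₁ ⟶ Y} (h₀ : IsFibre y₀ f i) (h₁ : IsFibre y₁ f j) :
    JointlyEpic y₀ y₁ := by
  refine jointlyEpic_of_classifier fun u v e₀ e₁ => ?_
  obtain ⟨u', hu, hu'⟩ := exists_image (lift (𝟙 Y) f) u
  obtain ⟨v', hv, hv'⟩ := exists_image (lift (𝟙 Y) f) v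
  have key : ∀ {k : 𝟙_ C ⟶ T} {Y' : C} {y : Y' ⟶ Y}, IsFibre y f k → y ≫ u = y ≫ v →
      lift (𝟙 Y) (const Y k) ≫ u' = lift (𝟙 Y) (const Y k) ≫ v' := by
    intro k Y' y hy e
    refine hom_ext_of_top fun W t => ?_
    rw [← Category.assoc, ← Category.assoc, hu', hv']
    refine exists_congr fun s => and_congr_right fun hs => ?_
    have hs₁ : s = t := by simpa using hs =≫ fst _ _
    have hs₂ : s ≫ f = const W k := by simpa using hs =≫ snd _ _
    obtain ⟨r, rfl⟩ := hy.lift s hs₂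
    rw [Category.assoc, Category.assoc, e]
  rw [← hu, ← hv, h.prod Y u' v' (key h₀ e₀) (key h₁ e₁)]

/-- An arrow `Y ⟶ 2` exhibits `Y` as the coproduct of its two fibres. -/
theorem isColimit_fibres {T : C} {i j : 𝟙_ C ⟶ T} (h : IsTwo i j) {Y Y₀ Y₁ : C}
    {f : Y ⟶ T} {y₀ : Y₀ ⟶ Y} {y₁ : Y₁ ⟶ Y} (h₀ : IsFibre y₀ f i) (h₁ : IsFibre y₁ f j) :
    Nonempty (IsColimit (BinaryCofan.mk y₀ y₁)) := by
  have hJ := (jointlyEpic_of_isColimit h).fibres h₀ h₁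
  refine nonempty_isColimit hJ fun Z a b => ?_
  have := h₀.mono
  have := h₁.mono
  -- `curry δ` is the singleton map. Truth-valued maps extend from a fibre to `Y`, so gluing is done
  -- in the power object of `Z`; the result lands in singletons since it does on both fibres.
  let δ : Z ⊗ Z ⟶ Ω C := χ (lift (𝟙 Z) (𝟙 Z))
  have : Mono (curry δ) := by
    refine ⟨fun {W} s t hst => ?_⟩
    rw [← curry_natural_left, ← curry_natural_left] at hst
    have e : lift s s ≫ δ = lift s t ≫ δ := by
      simpa using lift s (𝟙 W) ≫= curry_injective hst
    exact (lift_comp_χ_diag s t).1 (e.symm.trans ((lift_comp_χ_diag s s).2 rfl))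
  obtain ⟨a', ha, -⟩ := exists_image (Z ◁ y₀) (Z ◁ a ≫ δ)
  obtain ⟨b', hb, -⟩ := exists_image (Z ◁ y₁) (Z ◁ b ≫ δ)
  obtain ⟨H, hH₀, hH₁⟩ := exists_prod_desc h a' b'
  have key : ∀ {k : 𝟙_ C ⟶ T} {Y' : C} {y : Y' ⟶ Y}, IsFibre y f k →
      y ≫ curry (lift (𝟙 _) (snd Z Y ≫ f) ≫ H) =
        curry (Z ◁ y ≫ lift (𝟙 _) (const _ k) ≫ H) := by
    intro k Y' y hy
    rw [← curry_natural_left]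
    congr 1
    simp only [← Category.assoc]
    congr 1
    ext <;> simp [hy.comp]
  have k₀ := key h₀
  have k₁ := key h₁
  rw [hH₀, ha, curry_natural_left] at k₀
  rw [hH₁, hb, curry_natural_left] at k₁
  obtain ⟨d, hd⟩ := hJ.exists_lift (curry δ) _ ⟨a, k₀.symm⟩ ⟨b, k₁.symm⟩
  refine ⟨d, ?_, ?_⟩ <;> rw [← cancel_mono (curry δ), Category.assoc, hd]
  · exact k₀
  · exact k₁

end Topos

/-! ### Consequences of NS: two truth values, 2, decidable equality -/

section Nullstellensatz

variable {C : Type u} [Category.{v} C] [HasFiniteLimits C] [CartesianMonoidalCategory C]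
  [MonoidalClosed C] [HasSubobjectClassifier C]

omit [HasFiniteLimits C] [HasSubobjectClassifier C] in
theorem isInitial_of_hom {X I : C} (h : IsInitial I) (f : X ⟶ I) : Nonempty (IsInitial X) := by
  have := strict_initial h f
  exact ⟨h.ofIso (asIso f).symm⟩

omit [HasSubobjectClassifier C] in
theorem isInitial_of_const_eq (hNS : NS C) {X Y : C} {p q : 𝟙_ C ⟶ X} (hpq : p ≠ q)
    (h : const Y p = const Y q) : Nonempty (IsInitial Y) := by
  rcases hNS (equalizer p q) with ⟨⟨hI⟩⟩ | ⟨⟨s⟩⟩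
  · exact isInitial_of_hom hI (equalizer.lift (toUnit Y) h)
  · refine absurd ?_ hpq
    have e := s ≫= equalizer.condition p q
    rwa [← Category.assoc, ← Category.assoc, toUnit_unique (s ≫ _) (𝟙 _), Category.id_comp,
      Category.id_comp] at e

omit [HasFiniteLimits C] [MonoidalClosed C] in
theorem const_top (Y : C) : const Y (top (𝟙_ C)) = top Y := comp_top _

theorem point_ext (hNS : NS C) {u v : 𝟙_ C ⟶ Ω C} (h : u = top _ ↔ v = top _) : u = v := by
  by_cases hu : u = top _
  · rw [hu, h.1 hu]
  have key : ∀ {w w' : 𝟙_ C ⟶ Ω C}, w ≠ top _ → ∀ {Y : C} (t : Y ⟶ 𝟙_ C), t ≫ w = top Y →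
      t ≫ w' = top Y := by
    intro w w' hw Y t ht
    obtain ⟨hI⟩ := isInitial_of_const_eq hNS hw (Y := Y)
      (by rw [const_top, ← ht, const, toUnit_unique t])
    exact hI.hom_ext _ _
  exact hom_ext_of_top fun Y t => ⟨key hu t, key (fun hv => hu (h.2 hv)) t⟩

/-- Either all parallel arrows are equal, or the subobject classifier has two global elements. -/
theorem exists_ne_top (h : ∃ (X Y : C) (f g : X ⟶ Y), f ≠ g) :
    ∃ p : 𝟙_ C ⟶ Ω C, p ≠ top _ := by
  obtain ⟨X, Y, f, g, hfg⟩ := h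
  -- `χ m` is false, defined as "every truth value is true".
  let m := equalizer.ι (curry (fst (Ω C) (𝟙_ C))) (curry (top (Ω C ⊗ 𝟙_ C)))
  refine ⟨χ m, fun hm => hfg (eq_of_χ_equalizer_eq_top ?_)⟩
  have e := curry_injective (eq_of_χ_equalizer_eq_top hm)
  simpa using lift (χ (equalizer.ι f g)) (toUnit X) ≫= e

/-- The coproduct `2 = 1 + 1`, embedded in the subobject classifier by truth values. -/
structure IsTruthTwo {T : C} (i j : 𝟙_ C ⟶ T) (g : T ⟶ Ω C) : Prop where
  isTwo : IsTwo i j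
  mono : Mono g
  inl : i ≫ g = top _
  inr : j ≫ g ≠ top _

omit [HasFiniteLimits C] [MonoidalClosed C] in
theorem IsTruthTwo.ne {T : C} {i j : 𝟙_ C ⟶ T} {g : T ⟶ Ω C} (h : IsTruthTwo i j g) : i ≠ j :=
  fun e => h.inr (e ▸ h.inl)

omit [MonoidalClosed C] in
theorem lift_comp_χ_kernel {X Y Z : C} (π : X ⟶ Z) (s t : Y ⟶ X) :
    lift s t ≫ χ (equalizer.ι (fst X X ≫ π) (snd X X ≫ π)) = top Y ↔ s ≫ π = t ≫ π := by
  rw [comp_χ_eq_top_iff]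
  constructor
  · rintro ⟨r, hr⟩
    have e := r ≫= equalizer.condition (fst X X ≫ π) (snd X X ≫ π)
    simpa [reassoc_of% hr] using e
  · intro h
    exact ⟨equalizer.lift (lift s t) (by simpa using h), by simp⟩

/-- Truth values on a square can be compared on points. -/
theorem JointlyEpic.square_ext (hNS : NS C) {G : C} {i j : 𝟙_ C ⟶ G} (h : JointlyEpic i j)
    {u v : G ⊗ G ⟶ Ω C}
    (huv : ∀ x y : 𝟙_ C ⟶ G, (x = i ∨ x = j) → (y = i ∨ y = j) →
      (lift x y ≫ u = top _ ↔ lift x y ≫ v = top _)) : u = v := by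
  refine h.prod G u v (h _ _ ?_ ?_) (h _ _ ?_ ?_) <;>
  · simp only [← Category.assoc, comp_lift, Category.comp_id, comp_const, const_unit]
    exact point_ext hNS (huv _ _ (by simp) (by simp))

theorem exists_isTruthTwo (hNS : NS C) (h : ∃ (X Y : C) (f g : X ⟶ Y), f ≠ g) :
    ∃ (T : C) (i j : 𝟙_ C ⟶ T) (g : T ⟶ Ω C), IsTruthTwo i j g := by
  obtain ⟨p, hp⟩ := exists_ne_top h
  obtain ⟨T, g, i, j, hg, hi, hj, hJ⟩ := exists_jointlyEpic (top (𝟙_ C)) p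
  have hij : i ≠ j := by
    rintro rfl
    exact hp (hj.symm.trans hi)
  refine ⟨T, i, j, g, ⟨nonempty_isColimit hJ fun Z a b => ?_, hg, hi, hj ▸ hp⟩⟩
  -- `G` is the graph of the desired arrow: its projection to `T` is epic by the choice of `T`, and
  -- monic by comparing kernel pair and diagonal at four pairs of points.
  obtain ⟨G, γ, i', j', hγ, hi', hj', hJ'⟩ := exists_jointlyEpic (lift i a) (lift j b)
  let π : G ⟶ T := γ ≫ fst T Z
  have hπi : i' ≫ π = i := by simp [π, reassoc_of% hi']
  have hπj : j' ≫ π = j := by simp [π, reassoc_of% hj']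
  have : Epi π := by
    refine ⟨fun u v e => hJ u v ?_ ?_⟩
    · rw [← hπi, Category.assoc i' π, Category.assoc i' π, e]
    · rw [← hπj, Category.assoc j' π, Category.assoc j' π, e]
  have hκ : χ (equalizer.ι (fst G G ≫ π) (snd G G ≫ π)) = χ (lift (𝟙 G) (𝟙 G)) := by
    refine hJ'.square_ext hNS fun x y hx hy => ?_
    rw [lift_comp_χ_kernel, lift_comp_χ_diag]
    refine ⟨fun e => ?_, fun e => e ▸ rfl⟩
    rcases hx with rfl | rfl <;> rcases hy with rfl | rfl
    · rfl
    · exact absurd (hπi.symm.trans (e.trans hπj)) hij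
    · exact absurd (hπi.symm.trans (e.symm.trans hπj)) hij
    · rfl
  have : Mono π := by
    refine ⟨fun r s e => ?_⟩
    rwa [← lift_comp_χ_diag, ← hκ, lift_comp_χ_kernel]
  have : IsIso π := isIso_of_mono_of_epi π
  refine ⟨inv π ≫ γ ≫ snd T Z, ?_, ?_⟩
  · rw [← hπi]
    simp [reassoc_of% hi']
  · rw [← hπj]
    simp [reassoc_of% hj']

variable {T : C} {i j : 𝟙_ C ⟶ T} {g : T ⟶ Ω C}

/-- An arrow `e : X ⊗ X ⟶ 2` decides equality on `X`. -/
def DecidesEq {X : C} (e : X ⊗ X ⟶ T) (i : 𝟙_ C ⟶ T) : Prop :=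
  ∀ ⦃Y : C⦄ (s t : Y ⟶ X), lift s t ≫ e = const Y i ↔ s = t

theorem exists_decidesEq (hNS : NS C) (hT : IsTruthTwo i j g) {X : C} (hX : IsDecidable X) :
    ∃ e : X ⊗ X ⟶ T, DecidesEq e i := by
  obtain ⟨D, m, hm⟩ := hX
  obtain ⟨e, he₁, he₂⟩ := exists_desc hm (const X i) (const D j)
  have key : e ≫ g = χ (lift (𝟙 X) (𝟙 X)) := by
    refine jointlyEpic_of_isColimit hm _ _ ?_ ?_
    · rw [← Category.assoc, he₁, const_comp, hT.inl, const_top]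
      exact ((lift_comp_χ_diag _ _).2 rfl).symm
    · rw [← Category.assoc, he₂, const_comp]
      refine hom_ext_of_top fun W t => ⟨fun h => ?_, fun h => ?_⟩
      · rw [comp_const, ← const_top] at h
        obtain ⟨hI⟩ := isInitial_of_const_eq hNS hT.inr h
        exact hI.hom_ext _ _
      · rw [← Category.assoc, comp_χ_eq_top_iff] at h
        obtain ⟨s, hs⟩ := h
        have hc := hs =≫ e
        rw [Category.assoc, he₁, Category.assoc, he₂, comp_const, comp_const] at hc
        obtain ⟨hI⟩ := isInitial_of_const_eq hNS hT.ne hc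
        exact hI.hom_ext _ _
  have := hT.mono
  refine ⟨e, fun Y s t => ?_⟩
  rw [← lift_comp_χ_diag s t, ← key, ← cancel_mono g, const_comp, hT.inl, const_top,
    Category.assoc]

theorem DecidesEq.isDecidable (hT : IsTwo i j) {X : C} {e : X ⊗ X ⟶ T} (he : DecidesEq e i) :
    IsDecidable X := by
  refine ⟨_, _, isColimit_fibres hT (f := e) ⟨inferInstance, (he _ _).2 rfl, ?_⟩
    (isFibre_equalizer e j)⟩
  intro W t ht
  have ht' : lift (t ≫ fst _ _) (t ≫ snd _ _) = t := by ext <;> simp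
  refine ⟨t ≫ fst _ _, ?_⟩
  rw [← ht', he] at ht
  refine Eq.trans ?_ ht'
  simp [← ht]

theorem IsDecidable.of_mono (hNS : NS C) (hT : IsTruthTwo i j g) {X E : C} (hX : IsDecidable X)
    (m : E ⟶ X) [Mono m] : IsDecidable E := by
  obtain ⟨e, he⟩ := exists_decidesEq hNS hT hX
  refine DecidesEq.isDecidable hT.isTwo (e := lift (fst _ _ ≫ m) (snd _ _ ≫ m) ≫ e) ?_
  intro Y s t
  rw [← Category.assoc, comp_lift, he]
  simp [cancel_mono]

theorem IsTruthTwo.isDecidable (hNS : NS C) (hT : IsTruthTwo i j g) : IsDecidable T := by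
  obtain ⟨σ, hσi, hσj⟩ := exists_desc hT.isTwo j i
  -- The equality test on 2 is the biconditional, with `σ` as negation.
  obtain ⟨e, he₁, he₂⟩ := exists_prod_desc hT.isTwo (𝟙 T) σ
  have hi : ∀ x : 𝟙_ C ⟶ T, lift x i ≫ e = x := fun x => by
    have h := x ≫= he₁
    rwa [← Category.assoc, comp_lift, comp_const, const_unit, Category.comp_id] at h
  have hj : ∀ x : 𝟙_ C ⟶ T, lift x j ≫ e = x ≫ σ := fun x => by
    have h := x ≫= he₂
    rwa [← Category.assoc, comp_lift, comp_const, const_unit, Category.comp_id] at h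
  have key : e ≫ g = χ (lift (𝟙 T) (𝟙 T)) := by
    refine (jointlyEpic_of_isColimit hT.isTwo).square_ext hNS fun x y hx hy => ?_
    rw [lift_comp_χ_diag, ← Category.assoc]
    rcases hx with rfl | rfl <;> rcases hy with rfl | rfl
    · simp [hi, hT.inl]
    · simp [hj, hσi, hT.inr, hT.ne]
    · simp [hi, hT.inr, hT.ne.symm]
    · simp [hj, hσj, hT.inl]
  have := hT.mono
  refine DecidesEq.isDecidable hT.isTwo (e := e) fun Y s t => ?_
  rw [← lift_comp_χ_diag s t, ← key, ← cancel_mono g, const_comp, hT.inl, const_top,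
    Category.assoc]

/-- An arrow out of a decidable object along which every arrow to `2` factors is monic. -/
theorem mono_of_factors (hNS : NS C) (hT : IsTruthTwo i j g) {D Q : C} (hD : IsDecidable D)
    (k : D ⟶ Q) {T' : C} {i' j' : 𝟙_ C ⟶ T'} (hT' : IsTwo i' j')
    (hk : ∀ f : D ⟶ T', ∃ f' : Q ⟶ T', k ≫ f' = f) : Mono k := by
  obtain ⟨e, he⟩ := exists_decidesEq hNS hT hD
  obtain ⟨c, hci, hcj⟩ := exists_desc hT.isTwo i' j'
  obtain ⟨c', hc'i, hc'j⟩ := exists_desc hT' i j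
  refine ⟨fun {R} r s hrs => ?_⟩
  refine (jointlyEpic_of_isColimit hT.isTwo).fibres (isFibre_equalizer (lift r s ≫ e) i)
    (isFibre_equalizer (lift r s ≫ e) j) r s ?_ ?_
  · have h := (isFibre_equalizer (lift r s ≫ e) i).comp
    rwa [← Category.assoc, comp_lift, he] at h
  · rcases hNS (equalizer (lift r s ≫ e) (const R j)) with ⟨⟨hI⟩⟩ | ⟨⟨w⟩⟩
    · exact hI.hom_ext _ _
    · exfalso
      let x := w ≫ equalizer.ι (lift r s ≫ e) (const R j)
      have hx : lift (x ≫ r) (x ≫ s) ≫ e = j := by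
        have h := w ≫= (isFibre_equalizer (lift r s ≫ e) j).comp
        rw [comp_const, const_unit] at h
        rw [← h, ← comp_lift, Category.assoc, Category.assoc]
      have hx' : lift (x ≫ r) (x ≫ r) ≫ e = i := by
        have h := (he (x ≫ r) (x ≫ r)).2 rfl
        rwa [const_unit] at h
      -- The test "equal to `x ≫ r`" separates `x ≫ r` from `x ≫ s`, which `k` identifies.
      obtain ⟨f', hf'⟩ := hk (lift (const D (x ≫ r)) (𝟙 D) ≫ e ≫ c)
      have hr : x ≫ r ≫ k ≫ f' = i' := by
        rw [hf', ← hci, ← hx']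
        simp only [← Category.assoc, comp_lift, comp_const, const_unit, Category.comp_id]
      have hs : x ≫ s ≫ k ≫ f' = j' := by
        rw [hf', ← hcj, ← hx]
        simp only [← Category.assoc, comp_lift, comp_const, const_unit, Category.comp_id]
      have hij : i' = j' := by
        rw [← hr, ← hs, ← Category.assoc r, hrs, Category.assoc s]
      exact hT.ne (by rw [← hc'i, ← hc'j, hij])

end Nullstellensatz

/-! ### The unit as decidable quotient, and uniqueness -/

section Quotient

variable {C : Type u} [Category.{v} C] [HasFiniteLimits C] [CartesianMonoidalCategory C]
  [MonoidalClosed C] [HasSubobjectClassifier C]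

omit [HasFiniteLimits C] [MonoidalClosed C] [HasSubobjectClassifier C] in
theorem existsUnique_unit_comp [Reflective (dec C).ι] (X : C) {D : C} (hD : IsDecidable D)
    (f : X ⟶ D) :
    ∃! g, (reflectorAdjunction (dec C).ι).unit.app X ≫ g = f := by
  let D' : (dec C).FullSubcategory := ⟨D, hD⟩
  let adj := reflectorAdjunction (dec C).ι
  refine ⟨(dec C).ι.map ((adj.homEquiv X D').symm f), ?_, fun g hg => ?_⟩
  · have := (adj.homEquiv X D').apply_symm_apply f
    rwa [Adjunction.homEquiv_unit] at this
  · obtain ⟨g, rfl⟩ := (dec C).ι.map_surjective (Y := D') g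
    congr 1
    rw [← hg, Equiv.eq_symm_apply, Adjunction.homEquiv_unit]

theorem isDecidableQuotient_unit [Reflective (dec C).ι] (hNS : NS C) {T : C} {i j : 𝟙_ C ⟶ T}
    {g : T ⟶ Ω C} (hT : IsTruthTwo i j g) (X : C) :
    IsDecidableQuotient ((reflectorAdjunction (dec C).ι).unit.app X) := by
  have hdec : IsDecidable ((dec C).ι.obj ((reflector (dec C).ι).obj X)) :=
    ((reflector (dec C).ι).obj X).2
  refine ⟨⟨fun u v huv => ?_⟩, hdec, T, i, j, hT.isTwo,
    fun f => existsUnique_unit_comp X (hT.isDecidable hNS) f⟩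
  obtain ⟨r, hr, -⟩ := existsUnique_unit_comp X
    (hdec.of_mono hNS hT (equalizer.ι u v)) (equalizer.lift _ huv)
  have h : r ≫ equalizer.ι u v = 𝟙 _ :=
    (existsUnique_unit_comp X hdec _).unique (by rw [← Category.assoc, hr, equalizer.lift_ι])
      (Category.comp_id _)
  rw [← Category.id_comp u, ← Category.id_comp v, ← h, Category.assoc, Category.assoc,
    equalizer.condition]

theorem isIso_of_isDecidableQuotient (hNS : NS C) {T : C} {i j : 𝟙_ C ⟶ T}
    {g : T ⟶ Ω C} (hT : IsTruthTwo i j g) {X P Q : C} {p : X ⟶ P} {q : X ⟶ Q}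
    (hp : IsDecidableQuotient p) (hq : IsDecidableQuotient q) {k : P ⟶ Q} (hk : p ≫ k = q) :
    IsIso k := by
  obtain ⟨T', i', j', hT', h⟩ := hq.factors
  have := hp.epi
  have := hq.epi
  have : Epi k := by
    have : Epi (p ≫ k) := hk ▸ hq.epi
    exact epi_of_epi p k
  have : Mono k := by
    refine mono_of_factors hNS hT hp.decidable k hT' fun f => ?_
    obtain ⟨f', hf', -⟩ := h (p ≫ f)
    refine ⟨f', ?_⟩
    rwa [← hk, Category.assoc, cancel_epi] at hf'
  exact isIso_of_mono_of_epi k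

omit [HasFiniteLimits C] [CartesianMonoidalCategory C] [MonoidalClosed C] in
theorem isIso_of_subsingleton (h : ∀ (X Y : C) (f g : X ⟶ Y), f = g) {X Y : C} (f : X ⟶ Y) :
    IsIso f := by
  have : Mono f := ⟨fun _ _ _ => h _ _ _ _⟩
  have : Epi f := ⟨fun _ _ _ => h _ _ _ _⟩
  exact isIso_of_mono_of_epi f

omit [HasFiniteLimits C] [CartesianMonoidalCategory C] [MonoidalClosed C] in
theorem isColimit_of_subsingleton (h : ∀ (X Y : C) (f g : X ⟶ Y), f = g) {A B X : C}
    (a : A ⟶ X) (b : B ⟶ X) : Nonempty (IsColimit (BinaryCofan.mk a b)) := by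
  have := isIso_of_subsingleton h a
  exact nonempty_isColimit (fun _ _ _ _ _ => h _ _ _ _)
    fun _ f _ => ⟨inv a ≫ f, h _ _ _ _, h _ _ _ _⟩

omit [HasFiniteLimits C] [MonoidalClosed C] in
theorem isDecidableQuotient_of_subsingleton (h : ∀ (X Y : C) (f g : X ⟶ Y), f = g) {X Q : C}
    (q : X ⟶ Q) : IsDecidableQuotient q := by
  have := isIso_of_subsingleton h q
  exact ⟨inferInstance, ⟨_, 𝟙 _, isColimit_of_subsingleton h _ _⟩, _, 𝟙 _, 𝟙 _,
    isColimit_of_subsingleton h _ _, fun f => ⟨inv q ≫ f, h _ _ _ _, fun _ _ => h _ _ _ _⟩⟩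

end Quotient

end DecidableTopos

open DecidableTopos in
theorem corollaryT {C : Type u} [Category.{v} C] [HasFiniteLimits C]
    [CartesianMonoidalCategory C] [MonoidalClosed C] [HasSubobjectClassifier C]
    (hNS : DecidableTopos.NS C) [Reflective (DecidableTopos.dec C).ι] :
    DecidableTopos.DQO C ∧
      ∀ X : C, DecidableTopos.IsDecidableQuotient
        ((reflectorAdjunction (DecidableTopos.dec C).ι).unit.app X) := by
  have hunit : ∀ X : C, IsDecidableQuotient
      ((reflectorAdjunction (DecidableTopos.dec C).ι).unit.app X) := by
    intro X
    by_cases h : ∀ (X Y : C) (f g : X ⟶ Y), f = g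
    · exact isDecidableQuotient_of_subsingleton h _
    · push Not at h
      obtain ⟨T, i, j, g, hT⟩ := exists_isTruthTwo hNS h
      exact isDecidableQuotient_unit hNS hT X
  refine ⟨fun X => ⟨⟨_, _, hunit X⟩, fun Q Q' q q' hq hq' => ?_⟩, hunit⟩
  have := hq.epi
  have hiso : ∀ {R : C} {r : X ⟶ R} (_ : IsDecidableQuotient r)
      (k : (dec C).ι.obj ((reflector (dec C).ι).obj X) ⟶ R)
      (_ : (reflectorAdjunction (dec C).ι).unit.app X ≫ k = r), IsIso k := by
    intro R r hr k hk
    by_cases h : ∀ (X Y : C) (f g : X ⟶ Y), f = g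
    · exact isIso_of_subsingleton h k
    · push Not at h
      obtain ⟨T, i, j, g, hT⟩ := exists_isTruthTwo hNS h
      exact isIso_of_isDecidableQuotient hNS hT (hunit X) hr hk
  obtain ⟨k, hk, -⟩ := existsUnique_unit_comp X hq.decidable q
  obtain ⟨k', hk', -⟩ := existsUnique_unit_comp X hq'.decidable q'
  have := hiso hq k hk
  have := hiso hq' k' hk'
  have hq_inv : q ≫ inv k = (reflectorAdjunction (dec C).ι).unit.app X := by
    rw [← hk, Category.assoc, IsIso.hom_inv_id]
    exact Category.comp_id _
  refine ⟨(asIso k).symm ≪≫ asIso k', ?_, fun e he => ?_⟩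
  · simp only [Iso.trans_hom, Iso.symm_hom, asIso_inv, asIso_hom]
    rw [← Category.assoc, hq_inv, hk']
  · ext
    rw [← cancel_epi q, he]
    simp only [Iso.trans_hom, Iso.symm_hom, asIso_inv, asIso_hom]
    rw [← Category.assoc, hq_inv, hk']
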